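/- Theorem 3.2 (Bertini type theorem for complex manifolds). Let $M$ be a (finite-dimensional, Hausdorff) complex manifold which has a countable base of open subsets and only finitely many connected components, and let $\mathscr L$ be a holomorphic line bundle on $M$. Let $t_1,\dots,t_{N+1}\in H^0(M,\mathscr L)$ (not necessarily linearly independent) generate $\mathscr L$, that is, $W\otimes_{\mathbb C}\mathscr O_M\to\mathscr L$ is surjective, where $W\subset H^0(M,\mathscr L)$ is the linear span of $t_1,\dots,t_{N+1}$. Let $V=\bigoplus_{l=1}^{N+1}\mathbb C\,t_l\simeq\mathbb C^{N+1}$ be the formal direct sum, an $(N+1)$-dimensional vector space, and let $\Lambda=(V\setminus\{0\})/\mathbb C^\times\simeq\mathbb P^N$. Then there is a subset $\mathscr D\subset\Lambda$, dense in the classical topology, such that (i) $\Lambda\setminus\mathscr D$ is analytically meagre, i.e. contained in a countable union of locally closed analytic subsets of $\Lambda$ of codimension $\geq 1$; (ii) for each $[v]\in\mathscr D$ the section $s=\sum_l v_l t_l$ vanishes identically on no connected component of $M$, and the divisor $(s=0)$ on $M$ is smooth (possibly empty), i.e. the differential of $s$ in a local trivialization of $\mathscr L$ is non-zero at every zero of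 $s$. -/

import Mathlib

open Set Bundle Module
open scoped Manifold ContDiff LinearAlgebra.Projectivization

/-! ### Complex projective space as a complex manifold -/

namespace ProjSpace

variable {N : ℕ}

/-- Projective space carries the quotient topology of `V ∖ {0}`. -/
instance : TopologicalSpace (ℙ ℂ (Fin (N + 1) → ℂ)) :=
  inferInstanceAs (TopologicalSpace (Quotient (projectivizationSetoid ℂ (Fin (N + 1) → ℂ))))

/-- The open set `{[v] : v i ≠ 0}`. -/
def chartSource (i : Fin (N + 1)) : Set (ℙ ℂ (Fin (N + 1) → ℂ)) :=
  {p | Projectivization.lift (fun v : {v : Fin (N + 1) → ℂ // v ≠ 0} => v.1 i ≠ 0)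
    (by
      intro a b t h
      have ht : t ≠ 0 := by
        rintro rfl
        exact a.2 (by simpa using h)
      simp [h, ht]) p}

/-- The affine coordinates `[v] ↦ (v j / v i)_{j ≠ i}`. -/
noncomputable def toAffine (i : Fin (N + 1)) : ℙ ℂ (Fin (N + 1) → ℂ) → (Fin N → ℂ) :=
  Projectivization.lift
    (fun v : {v : Fin (N + 1) → ℂ // v ≠ 0} => fun j => v.1 (i.succAbove j) / v.1 i)
    (by
      intro a b t h
      have ht : t ≠ 0 := by
        rintro rfl
        exact a.2 (by simpa using h)
      funext j
      simp [h, mul_div_mul_left _ _ ht])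

theorem insertNth_one_ne_zero (i : Fin (N + 1)) (w : Fin N → ℂ) :
    (i.insertNth (1 : ℂ) w : Fin (N + 1) → ℂ) ≠ 0 := by
  intro h
  have := congrFun h i
  simp at this

/-- The point with affine coordinates `w`: the coordinate `1` is put in position `i`. -/
noncomputable def ofAffine (i : Fin (N + 1)) (w : Fin N → ℂ) : ℙ ℂ (Fin (N + 1) → ℂ) :=
  Projectivization.mk ℂ (i.insertNth (1 : ℂ) w) (insertNth_one_ne_zero i w)

theorem isQuotientMap_mk' :
    Topology.IsQuotientMap (Projectivization.mk' ℂ (V := Fin (N + 1) → ℂ)) :=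
  isQuotientMap_quot_mk

theorem isOpen_chartSource (i : Fin (N + 1)) : IsOpen (chartSource i) := by
  rw [← isQuotientMap_mk'.isOpen_preimage]
  exact isOpen_ne_fun ((continuous_apply i).comp continuous_subtype_val) continuous_const

/-- The standard affine chart `{[v] : v i ≠ 0} ≃ ℂ ^ N`. -/
noncomputable def affineChart (i : Fin (N + 1)) :
    OpenPartialHomeomorph (ℙ ℂ (Fin (N + 1) → ℂ)) (Fin N → ℂ) where
  toFun := toAffine i
  invFun := ofAffine i
  source := chartSource i
  target := univ
  map_source' _ _ := mem_univ _
  map_target' w _ := by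
    change (i.insertNth (1 : ℂ) w : Fin (N + 1) → ℂ) i ≠ 0
    simp
  left_inv' p := by
    induction p with
    | h v hv =>
      intro (hp : v i ≠ 0)
      change Projectivization.mk ℂ _ _ = _
      rw [Projectivization.mk_eq_mk_iff']
      refine ⟨(v i)⁻¹, ?_⟩
      funext j
      refine Fin.succAboveCases i ?_ (fun j => ?_) j
      · simp [hp]
      · simp [toAffine, div_eq_inv_mul]
  right_inv' w _ := by
    funext j
    simp [toAffine, ofAffine]
  open_source := isOpen_chartSource i
  open_target := isOpen_univ
  continuousOn_toFun := by
    rw [isQuotientMap_mk'.continuousOn_isOpen_iff (isOpen_chartSource i)]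
    refine continuousOn_pi.2 fun j => ContinuousOn.div ?_ ?_ (fun v hv => hv)
    · exact ((continuous_apply _).comp continuous_subtype_val).continuousOn
    · exact ((continuous_apply _).comp continuous_subtype_val).continuousOn
  continuousOn_invFun := by
    refine Continuous.continuousOn ?_
    have h : Continuous fun w : Fin N → ℂ => (i.insertNth (1 : ℂ) w : Fin (N + 1) → ℂ) :=
      Continuous.finInsertNth (A := fun _ => ℂ) i continuous_const continuous_id
    exact isQuotientMap_mk'.continuous.comp (h.subtype_mk (insertNth_one_ne_zero i))

theorem exists_mem_chartSource (p : ℙ ℂ (Fin (N + 1) → ℂ)) : ∃ i, p ∈ chartSource i := by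
  induction p with
  | h v hv => exact Function.ne_iff.1 hv

/-- Projective space with its atlas of `N + 1` standard affine charts. -/
noncomputable instance : ChartedSpace (Fin N → ℂ) (ℙ ℂ (Fin (N + 1) → ℂ)) where
  atlas := range affineChart
  chartAt p := affineChart (exists_mem_chartSource p).choose
  mem_chart_source p := (exists_mem_chartSource p).choose_spec
  chart_mem_atlas _ := mem_range_self _

/-- The standard affine charts make projective space a complex manifold. -/
instance : IsManifold 𝓘(ℂ, Fin N → ℂ) ω (ℙ ℂ (Fin (N + 1) → ℂ)) := by
  apply isManifold_of_contDiffOn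
  rintro _ _ ⟨i, rfl⟩ ⟨k, rfl⟩
  have key : ∀ l : Fin (N + 1),
      ContDiff ℂ ω (fun w : Fin N → ℂ => (i.insertNth (1 : ℂ) w : Fin (N + 1) → ℂ) l) := by
    intro l
    refine Fin.succAboveCases i ?_ (fun j => ?_) l
    · simpa using contDiff_const
    · simpa using contDiff_apply ℂ ℂ j
  refine contDiffOn_pi.2 fun j => ?_
  refine ContDiffOn.div (key (k.succAbove j)).contDiffOn (key k).contDiffOn ?_
  rintro w ⟨⟨-, hw⟩, -⟩
  exact hw

end ProjSpace

/-! ### Analytically meagre subsets of complex manifolds -/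

section Analytic

variable {E : Type*} [NormedAddCommGroup E] [NormedSpace ℂ E]
  {X : Type*} [TopologicalSpace X] [ChartedSpace E X]

variable (E) in
/-- `Y` is a locally closed analytic subset of `X`: every point of `Y` has an open neighbourhood
in `X` in which `Y` is the common zero set of finitely many holomorphic functions. -/
def IsLocallyClosedAnalytic (Y : Set X) : Prop :=
  ∀ p ∈ Y, ∃ U : Set X, IsOpen U ∧ p ∈ U ∧ ∃ (k : ℕ) (f : Fin k → X → ℂ),
    (∀ j, ContMDiffOn 𝓘(ℂ, E) 𝓘(ℂ, ℂ) ω (f j) U) ∧ Y ∩ U = {q ∈ U | ∀ j, f j q = 0}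

variable (E) in
/-- `Y` contains a holomorphically immersed piece of dimension `d`. The dimension of an analytic
set is the largest such `d`, that is the largest dimension of a complex submanifold in it. -/
def ContainsImmersedPiece (d : ℕ) (Y : Set X) : Prop :=
  ∃ (B : Set (Fin d → ℂ)) (φ : (Fin d → ℂ) → X), IsOpen B ∧ B.Nonempty ∧
    ContMDiffOn 𝓘(ℂ, Fin d → ℂ) 𝓘(ℂ, E) ω φ B ∧
    (∀ b ∈ B, Function.Injective (mfderiv 𝓘(ℂ, Fin d → ℂ) 𝓘(ℂ, E) φ b)) ∧ φ '' B ⊆ Y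

variable (E) in
/-- The analytic subset `Y` of the complex manifold `X` has codimension at least `c`, that is
`dim Y + c ≤ dim X`. (All of `X` has dimension `dim E`; the empty set satisfies this for
every `c`.) -/
def HasCodimAtLeast (c : ℕ) (Y : Set X) : Prop :=
  ∀ d : ℕ, ContainsImmersedPiece E d Y → d + c ≤ finrank ℂ E

variable (E) in
/-- `S` is contained in a countable union of locally closed analytic subsets of
codimension at least one. -/
def AnalyticallyMeagre (S : Set X) : Prop :=
  ∃ Y : ℕ → Set X,
    (∀ n, IsLocallyClosedAnalytic E (Y n) ∧ HasCodimAtLeast E 1 (Y n)) ∧ S ⊆ ⋃ n, Y n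

end Analytic

/-! ### Sections of holomorphic line bundles and their divisors -/

section LineBundle

variable {E : Type*} [NormedAddCommGroup E] [NormedSpace ℂ E]
  {M : Type*} [TopologicalSpace M] [ChartedSpace E M]
  {L : M → Type*} [TopologicalSpace (TotalSpace ℂ L)] [∀ x, AddCommGroup (L x)]
  [∀ x, Module ℂ (L x)] [∀ x, TopologicalSpace (L x)] [FiberBundle ℂ L] [VectorBundle ℂ ℂ L]

/-- The space `W` of global sections generates `L`: the sheaf map `W ⊗ 𝒪_M → L` is surjective,
that is, every local holomorphic section of `L` is locally a combination of elements of `W` with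
holomorphic coefficients. -/
def GeneratesLineBundle (W : Submodule ℂ (Cₛ^ω⟮𝓘(ℂ, E); ℂ, L⟯)) : Prop :=
  ∀ (U : Set M) (σ : ∀ x, L x), IsOpen U →
    ContMDiffOn 𝓘(ℂ, E) (𝓘(ℂ, E).prod 𝓘(ℂ, ℂ)) ω
      (fun y => (⟨y, σ y⟩ : TotalSpace ℂ L)) U →
    ∀ x ∈ U, ∃ U' : Set M, IsOpen U' ∧ x ∈ U' ∧ U' ⊆ U ∧
      ∃ (k : ℕ) (w : Fin k → Cₛ^ω⟮𝓘(ℂ, E); ℂ, L⟯) (g : Fin k → M → ℂ),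
        (∀ j, w j ∈ W) ∧ (∀ j, ContMDiffOn 𝓘(ℂ, E) 𝓘(ℂ, ℂ) ω (g j) U') ∧
        ∀ y ∈ U', σ y = ∑ j, g j y • w j y

/-- The local equation near `x` of the divisor of `s`: the section `s` read in the preferred
trivialization of `L` at `x`. -/
noncomputable def localEquation (s : Cₛ^ω⟮𝓘(ℂ, E); ℂ, L⟯) (x : M) : M → ℂ :=
  fun y => (trivializationAt ℂ L x ⟨y, s y⟩).2

/-- The divisor `(s = 0)` is well defined, that is `s` vanishes identically on no connected
component of `M`, and it is smooth (possibly empty): at each point `x` of its support the local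
equation has non-zero differential. This does not depend on the trivialization. Multiplicities
count: the divisor is, with its multiplicities, a disjoint union of smooth hypersurfaces. -/
def HasSmoothDivisor (s : Cₛ^ω⟮𝓘(ℂ, E); ℂ, L⟯) : Prop :=
  (∀ x : M, ∃ y ∈ connectedComponent x, s y ≠ 0) ∧
  ∀ x : M, s x = 0 → mfderiv 𝓘(ℂ, E) 𝓘(ℂ, ℂ) (localEquation s x) x ≠ 0

end LineBundle

/-! Generation gives each point of `M` a section `t l₀` that is nonzero nearby. Dividing by it turns
the members of the system into functions `∑ v_l q_l` with `q l₀ = 1`, and singular zeros of a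
section become common zeros of such a function and its differential. In an affine chart `i ≠ l₀` put
`Q(x, w) = q_i + ∑ w_j q_j` and `F(x, w) = w - Q(x, w) e`, with `e` the basis vector of the
coordinate `l₀`. Since `Q(x, F(x, w)) = 0`, the map `F` records the parameters of members vanishing
at `x`. A singular zero `x` of the member `w` makes `(x, w)` a critical point of `F` with value `w`
(`thin_singular_members`).

So a holomorphic Morse-Sard theorem is needed whose conclusion is analytic rather than
measure-theoretic: `criticalValuesThin`, by induction on the dimension of the source. Among critical
points of fixed rank, choose coordinates `(ρ, k)` in which part of the map is `ρ`; at these points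
the derivative along `k` vanishes. If it vanishes identically nearby, the image lies in a graph,
hence in a smooth hypersurface. Otherwise the point is a zero of finite multiplicity, so it lies on
a smooth hypersurface of the source, where induction applies.

Second countability leaves countably many local problems. Smooth hypersurfaces are nowhere dense, so
density follows from Baire's theorem. -/

open Filter Topology

/-! ### Countable unions of smooth hypersurfaces -/

section Thin

variable {T : Type*} [NormedAddCommGroup T] [NormedSpace ℂ T]

/-- `S` is contained in a countable union of locally closed smooth holomorphic hypersurfaces. -/
def Thin (S : Set T) : Prop :=
  ∃ (V : ℕ → Set T) (h : ℕ → T → ℂ),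
    (∀ n, IsOpen (V n) ∧ AnalyticOnNhd ℂ (h n) (V n) ∧ ∀ y ∈ V n, fderiv ℂ (h n) y ≠ 0) ∧
    S ⊆ ⋃ n, {y ∈ V n | h n y = 0}

theorem Thin.mono {S S' : Set T} (h : Thin S') (hS : S ⊆ S') : Thin S := by
  obtain ⟨V, f, h1, h2⟩ := h
  exact ⟨V, f, h1, hS.trans h2⟩

theorem thin_empty : Thin (∅ : Set T) :=
  ⟨fun _ => ∅, fun _ _ => 0, fun _ => ⟨isOpen_empty, by simp [AnalyticOnNhd], by simp⟩, by simp⟩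

theorem thin_hypersurface {V : Set T} {h : T → ℂ} (hV : IsOpen V) (hh : AnalyticOnNhd ℂ h V)
    (hd : ∀ y ∈ V, fderiv ℂ h y ≠ 0) : Thin {y ∈ V | h y = 0} :=
  ⟨fun _ => V, fun _ => h, fun _ => ⟨hV, hh, hd⟩, fun _ hy => mem_iUnion.2 ⟨0, hy⟩⟩

theorem thin_iUnion_nat {S : ℕ → Set T} (h : ∀ n, Thin (S n)) : Thin (⋃ n, S n) := by
  choose V f h1 h2 using h
  refine ⟨fun n => V n.unpair.1 n.unpair.2, fun n => f n.unpair.1 n.unpair.2,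
    fun n => h1 _ _, ?_⟩
  refine iUnion_subset fun n y hy => ?_
  obtain ⟨k, hk⟩ := mem_iUnion.1 (h2 n hy)
  exact mem_iUnion.2 ⟨Nat.pair n k, by simpa using hk⟩

theorem thin_iUnion {ι : Type*} [Countable ι] {S : ι → Set T} (h : ∀ i, Thin (S i)) :
    Thin (⋃ i, S i) := by
  rcases isEmpty_or_nonempty ι with hι | hι
  · simpa using thin_empty
  · obtain ⟨e, he⟩ := exists_surjective_nat ι
    rw [← he.iUnion_comp]
    exact thin_iUnion_nat fun n => h _

theorem Thin.union {S S' : Set T} (h : Thin S) (h' : Thin S') : Thin (S ∪ S') := by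
  rw [union_eq_iUnion]
  exact thin_iUnion fun b => by cases b <;> assumption

/-- By the Lindelöf property countably many of the neighbourhoods cover `S`. This makes every
thinness claim about images local on the source. -/
theorem thin_image_of_locally {G : Type*} [TopologicalSpace G] [SecondCountableTopology G]
    {F : G → T} {S : Set G} (h : ∀ a ∈ S, ∃ O ∈ 𝓝 a, Thin (F '' (S ∩ O))) : Thin (F '' S) := by
  classical
  choose! O hO hT using h
  obtain ⟨c, hcS, hc, hcov⟩ := TopologicalSpace.countable_cover_nhdsWithin
    (fun a ha => mem_nhdsWithin_of_mem_nhds (hO a ha))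
  have : Countable c := hc.to_subtype
  refine (thin_iUnion (S := fun a : c => F '' (S ∩ O a)) fun a => hT a (hcS a.2)).mono ?_
  rintro _ ⟨x, hx, rfl⟩
  obtain ⟨a, ha, hxa⟩ := mem_iUnion₂.1 (hcov hx)
  exact mem_iUnion.2 ⟨⟨a, ha⟩, x, ⟨hx, hxa⟩, rfl⟩

end Thin

/-! ### Local coordinates for submersions and zeros of finite order -/

section Straighten

variable {G R : Type*} [NormedAddCommGroup G] [NormedSpace ℂ G]
  [NormedAddCommGroup R] [NormedSpace ℂ R] [FiniteDimensional ℂ R]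

/-- A holomorphic submersion is a projection in suitable local coordinates. -/
theorem exists_straightening [FiniteDimensional ℂ G] {u : G → R} {a : G} (hu : AnalyticAt ℂ u a)
    (hs : Function.Surjective (fderiv ℂ u a)) {U : Set G} (hU : U ∈ 𝓝 a) :
    ∃ K : Submodule ℂ G, K = (fderiv ℂ u a).ker ∧ ∃ Φ : OpenPartialHomeomorph G (R × K),
      a ∈ Φ.source ∧ Φ.source ⊆ U ∧ AnalyticOnNhd ℂ Φ.symm Φ.target ∧ ∀ x, (Φ x).1 = u x := by
  have := FiniteDimensional.complete ℂ G
  have := FiniteDimensional.complete ℂ R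
  set f' := fderiv ℂ u a
  have := FiniteDimensional.complete ℂ f'.ker
  -- Completing `u` by a linear projection onto the kernel of its derivative gives a map with
  -- invertible derivative at `a`.
  obtain ⟨pr, hpr⟩ := Submodule.ClosedComplemented.of_finiteDimensional (𝕜 := ℂ) f'.ker
  have hinj : (f'.prod pr).ker = ⊥ := by
    rw [LinearMap.ker_eq_bot']
    intro x hx
    have h1 : f' x = 0 := congrArg Prod.fst hx
    have h2 : pr x = 0 := congrArg Prod.snd hx
    have h3 := hpr ⟨x, h1⟩
    rw [h2] at h3
    simpa using (congrArg Subtype.val h3).symm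
  have hsurj : (f'.prod pr).range = ⊤ := by
    rw [LinearMap.range_eq_top]
    rintro ⟨ρ, k⟩
    obtain ⟨x, hx⟩ := hs ρ
    have hk : ∀ k : f'.ker, f' k = 0 := fun k => k.2
    refine ⟨x + ((k - pr x : f'.ker) : G), Prod.ext ?_ ?_⟩
    · change f' _ = _
      rw [map_add, hk, hx, add_zero]
    · change pr _ = _
      rw [map_add, hpr]
      simp
  let e : G ≃L[ℂ] R × f'.ker := ContinuousLinearEquiv.ofBijective (f'.prod pr) hinj hsurj
  have he : (e : G →L[ℂ] R × f'.ker) = f'.prod pr := by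
    ext x <;> rfl
  have hΦa : AnalyticAt ℂ (fun x => (u x, pr x)) a := hu.prod (pr.analyticAt a)
  have hstrict : HasStrictFDerivAt (fun x => (u x, pr x)) (e : G →L[ℂ] R × f'.ker) a := by
    rw [he]
    exact hu.hasStrictFDerivAt.prodMk pr.hasStrictFDerivAt
  let Φ₀ := hstrict.toOpenPartialHomeomorph
  have hcoe : (Φ₀ : G → R × f'.ker) = fun x => (u x, pr x) :=
    hstrict.toOpenPartialHomeomorph_coe
  have ha₀ : a ∈ Φ₀.source := hstrict.mem_toOpenPartialHomeomorph_source
  have hsymm : AnalyticAt ℂ Φ₀.symm (Φ₀ a) :=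
    Φ₀.analyticAt_symm' (i := e) ha₀ (by rw [hcoe]; exact hΦa)
      (by rw [hcoe]; exact hstrict.hasFDerivAt.fderiv)
  have hopen : IsOpen {z | AnalyticAt ℂ Φ₀.symm z} := isOpen_analyticAt ℂ _
  obtain ⟨U', hU'U, hU'o, haU'⟩ := mem_nhds_iff.1 hU
  -- Shrink twice: the source into `U`, then the target to the open set where the inverse is
  -- analytic.
  let Φ₁ := Φ₀.restrOpen U' hU'o
  let Φ₂ := (Φ₁.symm.restrOpen _ hopen).symm
  refine ⟨f'.ker, rfl, Φ₂, ?_, ?_, ?_, ?_⟩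
  · change a ∈ Φ₁.source ∩ Φ₁ ⁻¹' _
    refine ⟨⟨ha₀, haU'⟩, hsymm⟩
  · intro x hx
    have : x ∈ Φ₁.source ∩ Φ₁ ⁻¹' _ := hx
    exact hU'U this.1.2
  · intro z hz
    have : z ∈ Φ₁.target ∩ {z | AnalyticAt ℂ Φ₀.symm z} := hz
    exact this.2
  · intro x
    change (Φ₀ x).1 = _
    rw [hcoe]

/-- If all derivatives of an analytic function vanish at a point, it vanishes nearby. -/
theorem exists_iteratedFDeriv_ne_zero {g : G → R} {a : G} (hg : AnalyticAt ℂ g a)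
    (h : ¬ ∀ᶠ x in 𝓝 a, g x = 0) : ∃ k, iteratedFDeriv ℂ k g a ≠ 0 := by
  by_contra! hz
  apply h
  have := FiniteDimensional.complete ℂ R
  obtain ⟨p, r, hp⟩ := hg
  have hball : Metric.eball a r ∈ 𝓝 a := Metric.eball_mem_nhds a hp.r_pos
  filter_upwards [hball] with x hx
  have hy : x - a ∈ Metric.eball (0 : G) r := by
    simpa [Metric.mem_eball, edist_eq_enorm_sub] using hx
  have hs := hp.hasSum_iteratedFDeriv hy
  simp only [hz, zero_apply, smul_zero, add_sub_cancel] at hs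
  exact hs.unique hasSum_zero

end Straighten

/-! ### Holomorphic Morse-Sard theorem -/

section Sard

universe u

/-- The critical values of holomorphic maps from open subsets of `G` to `T` form thin sets. -/
def CriticalValuesThin (G : Type*) [NormedAddCommGroup G] [NormedSpace ℂ G]
    (T : Type*) [NormedAddCommGroup T] [NormedSpace ℂ T] : Prop :=
  ∀ (U : Set G) (F : G → T), IsOpen U → AnalyticOnNhd ℂ F U →
    Thin (F '' {x ∈ U | ¬ Function.Surjective (fderiv ℂ F x)})

/-- By the chain rule the derivative of the composite has its range inside that of `F`. Hence
critical points survive restriction to hypersurfaces and changes of coordinates. -/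
theorem not_surjective_fderiv_comp {G G' T : Type*} [NormedAddCommGroup G] [NormedSpace ℂ G]
    [NormedAddCommGroup G'] [NormedSpace ℂ G'] [NormedAddCommGroup T] [NormedSpace ℂ T]
    {F : G → T} {P : G' → G} {z : G'} (hF : DifferentiableAt ℂ F (P z))
    (hP : DifferentiableAt ℂ P z) (h : ¬ Function.Surjective (fderiv ℂ F (P z))) :
    ¬ Function.Surjective (fderiv ℂ (fun z => F (P z)) z) := by
  intro hs
  apply h
  intro y
  obtain ⟨x, hx⟩ := hs y
  rw [fderiv_fun_comp z hF hP] at hx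
  exact ⟨_, hx⟩

variable {G : Type u} [NormedAddCommGroup G] [NormedSpace ℂ G] [FiniteDimensional ℂ G]
  {T : Type} [NormedAddCommGroup T] [NormedSpace ℂ T]

/-- Critical points on smooth hypersurfaces have thin image, by restriction to the hypersurface. -/
theorem thin_image_critical_of_fderiv_ne_zero
    (ih : ∀ K : Submodule ℂ G, K ≠ ⊤ → CriticalValuesThin K T)
    {Z : Type*} [NormedAddCommGroup Z] [NormedSpace ℂ Z] {U : Set G} {F : G → T} {γ : G → Z}
    (hU : IsOpen U) (hF : AnalyticOnNhd ℂ F U) (hγ : AnalyticOnNhd ℂ γ U) :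
    Thin (F '' {x ∈ U | ¬ Function.Surjective (fderiv ℂ F x) ∧ γ x = 0 ∧ fderiv ℂ γ x ≠ 0}) := by
  refine thin_image_of_locally ?_
  rintro a ⟨haU, -, -, hd⟩
  obtain ⟨w, hw⟩ : ∃ w, fderiv ℂ γ a w ≠ 0 := by
    by_contra! h
    exact hd (ContinuousLinearMap.ext h)
  -- A scalar component of `γ` with nonzero differential suffices: its zero set is a smooth
  -- hypersurface containing the zeros of `γ`, parametrized below by `k ↦ Φ.symm (0, k)`.
  obtain ⟨l, hl⟩ := SeparatingDual.exists_ne_zero (R := ℂ) hw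
  have hu : AnalyticAt ℂ (fun x => l (γ x)) a := (l.analyticAt _).fun_comp (hγ a haU)
  have hfd : fderiv ℂ (fun x => l (γ x)) a = l.comp (fderiv ℂ γ a) :=
    (l.hasFDerivAt.comp a (hγ a haU).differentiableAt.hasFDerivAt).fderiv
  have hne : fderiv ℂ (fun x => l (γ x)) a w ≠ 0 := by
    rw [hfd]
    exact hl
  have hsurj : Function.Surjective (fderiv ℂ (fun x => l (γ x)) a) :=
    LinearMap.surjective (f := (fderiv ℂ (fun x => l (γ x)) a : G →ₗ[ℂ] ℂ))
      fun h => hne (LinearMap.congr_fun h w)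
  obtain ⟨K, hK, Φ, haΦ, hΦU, hΦ, hΦ1⟩ := exists_straightening hu hsurj (hU.mem_nhds haU)
  have hKtop : K ≠ ⊤ := by
    rintro rfl
    have : w ∈ (⊤ : Submodule ℂ G) := trivial
    rw [hK] at this
    exact hne this
  refine ⟨Φ.source, Φ.open_source.mem_nhds haΦ, ?_⟩
  have hι : AnalyticOnNhd ℂ (fun k : K => ((0 : ℂ), k)) univ :=
    fun k _ => analyticAt_const.prod analyticAt_id
  have hP : AnalyticOnNhd ℂ (fun k : K => Φ.symm (0, k)) ((fun k : K => ((0 : ℂ), k)) ⁻¹' Φ.target) :=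
    fun k hk => (hΦ _ hk).fun_comp (f := fun k : K => ((0 : ℂ), k)) (hι k trivial)
  have hmem : ∀ k ∈ (fun k : K => ((0 : ℂ), k)) ⁻¹' Φ.target, Φ.symm (0, k) ∈ U :=
    fun k hk => hΦU (Φ.map_target hk)
  refine (ih K hKtop _ (fun k => F (Φ.symm (0, k)))
    (Φ.open_target.preimage (Continuous.prodMk_right _))
    fun k hk => (hF _ (hmem k hk)).fun_comp (f := fun k : K => Φ.symm (0, k)) (hP k hk)).mono ?_
  rintro _ ⟨x, ⟨⟨hxU, hxs, hx0, -⟩, hxΦ⟩, rfl⟩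
  have hx : Φ x = (0, (Φ x).2) := Prod.ext (by rw [hΦ1, hx0, map_zero]) rfl
  have hx' : Φ.symm (0, (Φ x).2) = x := by rw [← hx, Φ.left_inv hxΦ]
  have ht : (Φ x).2 ∈ (fun k : K => ((0 : ℂ), k)) ⁻¹' Φ.target := by
    rw [mem_preimage, ← hx]
    exact Φ.map_source hxΦ
  refine ⟨(Φ x).2, ⟨ht, ?_⟩, by simp only [hx']⟩
  refine not_surjective_fderiv_comp (F := F) (P := fun k : K => Φ.symm (0, k))
    (hF _ (hmem _ ht)).differentiableAt (hP _ ht).differentiableAt ?_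
  simpa only [hx'] using hxs

/-- Critical points on the zero set of a not locally vanishing holomorphic function have thin
image: order the zeros by their multiplicity. -/
theorem thin_image_critical_of_not_eventually_zero
    (ih : ∀ K : Submodule ℂ G, K ≠ ⊤ → CriticalValuesThin K T)
    {Z : Type*} [NormedAddCommGroup Z] [NormedSpace ℂ Z] [FiniteDimensional ℂ Z]
    {U : Set G} {F : G → T} {g : G → Z}
    (hU : IsOpen U) (hF : AnalyticOnNhd ℂ F U) (hg : AnalyticOnNhd ℂ g U) :
    Thin (F '' {x ∈ U | ¬ Function.Surjective (fderiv ℂ F x) ∧ g x = 0 ∧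
      ¬ ∀ᶠ y in 𝓝 x, g y = 0}) := by
  classical
  have := FiniteDimensional.complete ℂ Z
  refine (thin_iUnion fun k => thin_image_critical_of_fderiv_ne_zero ih hU hF
    (hg.iteratedFDeriv k)).mono ?_
  rintro _ ⟨x, ⟨hxU, hxs, hx0, hxn⟩, rfl⟩
  -- If `k + 1` is the least order of a nonzero derivative at `x`, the `k`-th derivative vanishes at
  -- `x` but its differential does not.
  have hex := exists_iteratedFDeriv_ne_zero (hg x hxU) hxn
  have hpos : Nat.find hex ≠ 0 := by
    intro h
    have h1 := Nat.find_spec hex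
    rw [h] at h1
    exact h1 (by ext; simp [hx0])
  obtain ⟨k, hk⟩ := Nat.exists_eq_succ_of_ne_zero hpos
  refine mem_iUnion.2 ⟨k, x, ⟨hxU, hxs, ?_, ?_⟩, rfl⟩
  · by_contra h
    exact Nat.find_min hex (m := k) (by omega) h
  · have h1 := Nat.find_spec hex
    rw [hk] at h1
    intro h
    apply h1
    ext m
    rw [iteratedFDeriv_succ_apply_left, h]
    simp

/-- A map whose components along `R` are coordinates and which locally does not depend on the other
coordinates has locally thin image. -/
theorem exists_thin_image_of_fderiv_inr_eq_zero [FiniteDimensional ℂ T] {R : Submodule ℂ T} (hR : R ≠ ⊤)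
    {p : T →L[ℂ] R} (hp : ∀ y : R, p y = y)
    {K : Type*} [NormedAddCommGroup K] [NormedSpace ℂ K]
    {Ω : Set (R × K)} (hΩ : IsOpen Ω) {H : R × K → T} (hH : AnalyticOnNhd ℂ H Ω)
    (hpH : ∀ z ∈ Ω, p (H z) = z.1) {z₀ : R × K} (hz₀ : z₀ ∈ Ω)
    (h0 : ∀ᶠ z in 𝓝 z₀, (fderiv ℂ H z).comp (ContinuousLinearMap.inr ℂ R K) = 0) :
    ∃ O ∈ 𝓝 z₀, Thin (H '' O) := by
  obtain ⟨ε, hε, hball⟩ := Metric.mem_nhds_iff.1 (inter_mem (hΩ.mem_nhds hz₀) h0)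
  obtain ⟨ρ₀, k₀⟩ := z₀
  have hmem : ∀ ρ ∈ Metric.ball ρ₀ ε, ∀ k ∈ Metric.ball k₀ ε, (ρ, k) ∈ Metric.ball (ρ₀, k₀) ε := by
    intro ρ hρ k hk
    rw [← ball_prod_same]
    exact ⟨hρ, hk⟩
  have hconst : ∀ ρ ∈ Metric.ball ρ₀ ε, ∀ k ∈ Metric.ball k₀ ε, H (ρ, k) = H (ρ, k₀) := by
    intro ρ hρ k hk
    have hd : ∀ k ∈ Metric.ball k₀ ε, HasFDerivAt (fun k => H (ρ, k)) (0 : K →L[ℂ] T) k := by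
      intro k hk
      have h1 := hball (hmem ρ hρ k hk)
      have h2 := (hH _ h1.1).differentiableAt.hasFDerivAt.comp k (hasFDerivAt_prodMk_right ρ k)
      have h3 : (fderiv ℂ H (ρ, k)).comp (ContinuousLinearMap.inr ℂ R K) = 0 := h1.2
      rw [h3] at h2
      exact h2
    refine Metric.isOpen_ball.is_const_of_fderiv_eq_zero (𝕜 := ℂ) (f := fun k => H (ρ, k))
      (convex_ball k₀ ε).isPreconnected
      (fun k hk => (hd k hk).differentiableAt.differentiableWithinAt)
      (fun k hk => (hd k hk).fderiv) hk (Metric.mem_ball_self hε)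
  -- Near `z₀` the value of `H` depends only on `ρ = p (H z)`, so it satisfies `l y = l (H (p y,
  -- k₀))`. As `l` kills `R`, this is a nontrivial equation.
  obtain ⟨l', hl'0, hl'R⟩ := Submodule.exists_le_ker_of_lt_top R (lt_top_iff_ne_top.2 hR)
  let l : T →L[ℂ] ℂ := LinearMap.toContinuousLinearMap l'
  have hlR : ∀ y : R, l y = 0 := fun y => hl'R y.2
  obtain ⟨w, hw⟩ : ∃ w, l w ≠ 0 := by
    by_contra! h
    exact hl'0 (LinearMap.ext h)
  have hG₀ : AnalyticOnNhd ℂ (fun ρ : R => l (H (ρ, k₀))) (Metric.ball ρ₀ ε) := by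
    intro ρ hρ
    have h1 := hball (hmem ρ hρ k₀ (Metric.mem_ball_self hε))
    exact (l.analyticAt _).fun_comp ((hH _ h1.1).fun_comp (f := fun ρ : R => (ρ, k₀))
      (analyticAt_id.prod analyticAt_const))
  refine ⟨Metric.ball (ρ₀, k₀) ε, Metric.ball_mem_nhds _ hε, (thin_hypersurface
    (V := p ⁻¹' Metric.ball ρ₀ ε) (h := fun y => l y - l (H (p y, k₀)))
    (Metric.isOpen_ball.preimage p.continuous) ?_ ?_).mono ?_⟩
  · intro y hy
    exact (l.analyticAt y).sub ((hG₀ _ hy).fun_comp (f := fun y => p y) (p.analyticAt y))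
  · intro y hy h
    have h1 := l.hasFDerivAt.sub
      ((hG₀ _ hy).differentiableAt.hasFDerivAt.comp y (p.hasFDerivAt (x := y)))
    have h2 : fderiv ℂ (fun y => l y - l (H (p y, k₀))) y = _ := h1.fderiv
    rw [h2] at h
    -- This direction is killed by `p`, so only `l` contributes, with value `l w ≠ 0`.
    have h3 := DFunLike.congr_fun h (w - (p w : T))
    have h4 : p (w - (p w : T)) = 0 := by rw [map_sub, hp, sub_self]
    rw [sub_apply, ContinuousLinearMap.comp_apply, h4, map_sub, hlR, map_zero, sub_zero,
      sub_zero, zero_apply] at h3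
    exact hw h3
  · rintro _ ⟨⟨ρ, k⟩, hz, rfl⟩
    have hz' := hz
    rw [← ball_prod_same] at hz'
    have hpz : p (H (ρ, k)) = ρ := hpH _ (hball hz).1
    refine ⟨?_, ?_⟩
    · rw [mem_preimage, hpz]
      exact hz'.1
    · rw [hpz, hconst ρ hz'.1 k hz'.2, sub_self]

/-- The holomorphic Morse-Sard theorem for points of fixed rank. -/
theorem thin_image_critical_of_finrank_eq [FiniteDimensional ℂ T]
    (ih : ∀ (G' : Type u) [NormedAddCommGroup G'] [NormedSpace ℂ G'] [FiniteDimensional ℂ G'],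
      finrank ℂ G' < finrank ℂ G → CriticalValuesThin G' T)
    {U : Set G} {F : G → T} (hU : IsOpen U) (hF : AnalyticOnNhd ℂ F U) (r : ℕ) :
    Thin (F '' {x ∈ U | ¬ Function.Surjective (fderiv ℂ F x) ∧
      finrank ℂ (fderiv ℂ F x).range = r}) := by
  have := FiniteDimensional.complete ℂ T
  set S := {x ∈ U | ¬ Function.Surjective (fderiv ℂ F x) ∧
      finrank ℂ (fderiv ℂ F x).range = r}
  -- Points of `A` need no induction. Outside `A` the derivative along `K` cannot vanish identically
  -- near the point.
  set A := {x : G | ∃ O ∈ 𝓝 x, Thin (F '' O)}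
  have hSA : Thin (F '' (S ∩ A)) := by
    refine thin_image_of_locally ?_
    rintro x ⟨-, O, hO, hT⟩
    exact ⟨O, hO, hT.mono (image_mono inter_subset_right)⟩
  suffices hSA' : Thin (F '' (S \ A)) by
    rw [← inter_union_sdiff S A, image_union]
    exact hSA.union hSA'
  refine thin_image_of_locally ?_
  rintro a ⟨⟨haU, has, har⟩, -⟩
  set R := (fderiv ℂ F a).range
  have hRtop : R ≠ ⊤ := fun h => has (LinearMap.range_eq_top.1 h)
  obtain ⟨p, hp⟩ := Submodule.ClosedComplemented.of_finiteDimensional (𝕜 := ℂ) R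
  have hu : AnalyticAt ℂ (fun x => p (F x)) a := (p.analyticAt _).fun_comp (hF a haU)
  have hfd : fderiv ℂ (fun x => p (F x)) a = p.comp (fderiv ℂ F a) :=
    (p.hasFDerivAt.comp a (hF a haU).differentiableAt.hasFDerivAt).fderiv
  have hsurj : Function.Surjective (fderiv ℂ (fun x => p (F x)) a) := by
    rintro ⟨_, x, rfl⟩
    refine ⟨x, ?_⟩
    rw [hfd]
    exact hp ⟨_, x, rfl⟩
  obtain ⟨K, hK, Φ, haΦ, hΦU, hΦ, hΦ1⟩ := exists_straightening hu hsurj (hU.mem_nhds haU)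
  have hdim : finrank ℂ (R × K) = finrank ℂ G := by
    rw [Module.finrank_prod, hK, ← LinearMap.finrank_range_add_finrank_ker
      (fderiv ℂ (fun x => p (F x)) a : G →ₗ[ℂ] R), LinearMap.range_eq_top.2 hsurj, finrank_top]
  set H : R × K → T := fun z => F (Φ.symm z) with hHdef
  have hmem : ∀ z ∈ Φ.target, Φ.symm z ∈ U := fun z hz => hΦU (Φ.map_target hz)
  have hH : AnalyticOnNhd ℂ H Φ.target := fun z hz => (hF _ (hmem z hz)).fun_comp (hΦ z hz)
  have hpH : ∀ z ∈ Φ.target, p (H z) = z.1 := by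
    intro z hz
    rw [← Φ.right_inv hz, hΦ1]
    simp only [hHdef]
    rw [Φ.right_inv hz]
  have hg : AnalyticOnNhd ℂ
      (fun z => (fderiv ℂ H z).comp (ContinuousLinearMap.inr ℂ R K)) Φ.target := by
    intro z hz
    exact (((ContinuousLinearMap.compL ℂ K (R × K) T).flip
      (ContinuousLinearMap.inr ℂ R K)).analyticAt _).fun_comp (hH.fderiv z hz)
  -- `R × K` has the dimension of `G`, so its proper subspaces fall under `ih`; since `T` is in
  -- `Type`, they also stay in the universe of `G`.
  have key := thin_image_critical_of_not_eventually_zero (G := R × K)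
    (fun K' hK' => ih K' (by rw [← hdim]; exact Submodule.finrank_lt hK')) Φ.open_target hH hg
  refine ⟨Φ.source, Φ.open_source.mem_nhds haΦ, key.mono ?_⟩
  rintro _ ⟨x, ⟨⟨⟨hxU, hxs, hxr⟩, hxA⟩, hxΦ⟩, rfl⟩
  have hxt := Φ.map_source hxΦ
  have hxl : Φ.symm (Φ x) = x := Φ.left_inv hxΦ
  have hFd : DifferentiableAt ℂ F (Φ.symm (Φ x)) := by
    rw [hxl]; exact (hF x hxU).differentiableAt
  have hΦd : DifferentiableAt ℂ Φ.symm (Φ x) := (hΦ _ hxt).differentiableAt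
  refine ⟨Φ x, ⟨hxt, ?_, ?_, ?_⟩, by simp only [hHdef, hxl]⟩
  · refine not_surjective_fderiv_comp hFd hΦd ?_
    rwa [hxl]
  · have hchain : fderiv ℂ H (Φ x) = (fderiv ℂ F x).comp (fderiv ℂ Φ.symm (Φ x)) := by
      have := fderiv_fun_comp (Φ x) hFd hΦd
      rw [hxl] at this
      exact this
    have hpd : p.comp (fderiv ℂ H (Φ x)) = ContinuousLinearMap.fst ℂ R K := by
      have h1 : HasFDerivAt (fun z => p (H z)) (p.comp (fderiv ℂ H (Φ x))) (Φ x) :=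
        p.hasFDerivAt.comp _ (hH _ hxt).differentiableAt.hasFDerivAt
      have h2 : HasFDerivAt (fun z => p (H z)) (ContinuousLinearMap.fst ℂ R K) (Φ x) :=
        hasFDerivAt_fst.congr_of_eventuallyEq
          (eventually_of_mem (Φ.open_target.mem_nhds hxt) hpH)
      exact h1.unique h2
    -- Constant rank enters here: `p` maps the range of the derivative at `x` onto `R`, which has
    -- the same dimension, hence injectively. Directions along `K` have image killed by `p`, so that
    -- image is zero.
    have hps : Function.Surjective (p.toLinearMap.domRestrict (fderiv ℂ F x).range) := by
      intro ρ
      have h1 := DFunLike.congr_fun hpd (ρ, 0)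
      rw [hchain] at h1
      exact ⟨⟨fderiv ℂ F x (fderiv ℂ Φ.symm (Φ x) (ρ, 0)), _, rfl⟩, h1⟩
    have hpi : Function.Injective (p.toLinearMap.domRestrict (fderiv ℂ F x).range) :=
      (LinearMap.injective_iff_surjective_of_finrank_eq_finrank (hxr.trans har.symm)).2 hps
    ext k
    have h1 := DFunLike.congr_fun hpd (0, k)
    rw [hchain] at h1
    have h2 := @hpi ⟨fderiv ℂ F x (fderiv ℂ Φ.symm (Φ x) (0, k)), _, rfl⟩ 0
      (by rw [map_zero]; exact h1)
    rw [hchain]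
    exact congrArg Subtype.val h2
  · intro h0
    apply hxA
    obtain ⟨O, hO, hT⟩ := exists_thin_image_of_fderiv_inr_eq_zero hRtop hp Φ.open_target hH hpH
      hxt h0
    refine ⟨Φ.source ∩ Φ ⁻¹' O, Φ.continuousAt hxΦ |>.preimage_mem_nhds hO |> inter_mem
      (Φ.open_source.mem_nhds hxΦ), hT.mono ?_⟩
    rintro _ ⟨y, ⟨hy, hyO⟩, rfl⟩
    exact ⟨Φ y, hyO, by simp only [hHdef, Φ.left_inv hy]⟩

/-- The holomorphic Morse-Sard theorem: the critical values of a holomorphic map lie in a countable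
union of locally closed smooth hypersurfaces. -/
theorem criticalValuesThin [FiniteDimensional ℂ T] (G : Type u) [NormedAddCommGroup G] [NormedSpace ℂ G]
    [FiniteDimensional ℂ G] : CriticalValuesThin G T := by
  induction hm : finrank ℂ G using Nat.strong_induction_on generalizing G with
  | _ m ih =>
    subst hm
    intro U F hU hF
    refine (thin_iUnion fun r => thin_image_critical_of_finrank_eq
      (fun G' _ _ _ h => ih _ h G' rfl) hU hF r).mono ?_
    rintro _ ⟨x, ⟨hx, hxs⟩, rfl⟩
    exact mem_iUnion.2 ⟨_, x, ⟨hx, hxs, rfl⟩, rfl⟩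

end Sard

/-! ### Singular members of a linear system of functions -/

section LinearSystem

variable {E : Type*} [NormedAddCommGroup E] [NormedSpace ℂ E] [FiniteDimensional ℂ E]

/-- In a linear system of functions containing a unit, the members that are singular somewhere
form a thin set of parameters. -/
theorem thin_singular_members {N : ℕ} {U : Set E} (hU : IsOpen U) {q₀ : E → ℂ}
    {q : Fin N → E → ℂ} (hq₀ : AnalyticOnNhd ℂ q₀ U) (hq : ∀ j, AnalyticOnNhd ℂ (q j) U)
    {j₀ : Fin N} (hj₀ : ∀ x ∈ U, q j₀ x = 1) :
    Thin {w : Fin N → ℂ | ∃ x ∈ U, q₀ x + ∑ j, w j * q j x = 0 ∧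
      fderiv ℂ (fun x => q₀ x + ∑ j, w j * q j x) x = 0} := by
  set Q : E × (Fin N → ℂ) → ℂ := fun z => q₀ z.1 + ∑ j, z.2 j * q j z.1 with hQdef
  have hQ : AnalyticOnNhd ℂ Q (U ×ˢ univ) := by
    rintro z ⟨hz, -⟩
    refine ((hq₀ _ hz).fun_comp analyticAt_fst).add
      (Finset.univ.analyticAt_fun_sum fun j _ => ?_)
    exact (((ContinuousLinearMap.proj (R := ℂ) (φ := fun _ : Fin N => ℂ) j).analyticAt _).fun_comp
      analyticAt_snd).mul ((hq j _ hz).fun_comp analyticAt_fst)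
  -- Because `q j₀ = 1`, this correction moves `w` to a parameter whose member vanishes at `x`, and
  -- fixes `w` when `Q (x, w) = 0`.
  set F : E × (Fin N → ℂ) → (Fin N → ℂ) := fun z => z.2 - Q z • Pi.single j₀ 1 with hFdef
  have hF : AnalyticOnNhd ℂ F (U ×ˢ univ) :=
    fun z hz => analyticAt_snd.sub ((hQ z hz).smul analyticAt_const)
  refine (criticalValuesThin (E × (Fin N → ℂ)) _ F (hU.prod isOpen_univ) hF).mono ?_
  rintro w ⟨x, hx, h0, hd⟩
  have hQ0 : Q (x, w) = 0 := h0
  refine ⟨(x, w), ⟨⟨hx, trivial⟩, ?_⟩, by simp [hFdef, hQ0]⟩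
  have hQd := (hQ (x, w) ⟨hx, trivial⟩).differentiableAt.hasFDerivAt
  have h1 : (fderiv ℂ Q (x, w)).comp (ContinuousLinearMap.inl ℂ E (Fin N → ℂ)) = 0 := by
    rw [← hd]
    exact (hQd.comp (𝕜 := ℂ) x (hasFDerivAt_prodMk_left x w)).fderiv.symm
  have h2 : ∀ v, fderiv ℂ Q (x, w) (0, v) = ∑ j, v j * q j x := by
    intro v
    have h3 := hQd.comp w (hasFDerivAt_prodMk_right x w)
    let A : (Fin N → ℂ) →L[ℂ] ℂ :=
      ∑ j, (q j x) • ContinuousLinearMap.proj (R := ℂ) (φ := fun _ : Fin N => ℂ) j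
    have h4 : HasFDerivAt (fun w : Fin N → ℂ => q₀ x + A w) A w := A.hasFDerivAt.const_add _
    have h5 : (fun w : Fin N → ℂ => q₀ x + A w) = Q ∘ fun v => (x, v) := by
      funext v
      simp [A, hQdef, mul_comm]
    rw [h5] at h4
    have h6 := DFunLike.congr_fun (h3.unique h4) v
    simpa [A, mul_comm] using h6
  have hFd : HasFDerivAt F (ContinuousLinearMap.snd ℂ E (Fin N → ℂ) -
      (fderiv ℂ Q (x, w)).smulRight (Pi.single j₀ 1)) (x, w) :=
    hasFDerivAt_snd.sub (hQd.smul_const _)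
  rw [hFd.fderiv]
  intro hs
  -- The functional `v ↦ ∑ j, v j * q j x` annihilates the range of the derivative of `F` but is `1`
  -- on this vector.
  obtain ⟨⟨x', v⟩, hv⟩ := hs (Pi.single j₀ 1)
  have h7 : fderiv ℂ Q (x, w) (x', v) = ∑ j, v j * q j x := by
    have h8 : fderiv ℂ Q (x, w) (x', 0) = 0 := DFunLike.congr_fun h1 x'
    have h9 : ((x', v) : E × (Fin N → ℂ)) = (x', 0) + (0, v) := by simp
    rw [h9, map_add, h8, h2, zero_add]
  have h10 := congrArg (fun v : Fin N → ℂ => ∑ j, v j * q j x) hv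
  simp only [sub_apply, ContinuousLinearMap.coe_snd', ContinuousLinearMap.smulRight_apply, h7,
    Pi.sub_apply, Pi.smul_apply, smul_eq_mul, sub_mul, Finset.sum_sub_distrib, mul_assoc,
    ← Finset.mul_sum] at h10
  simp [Pi.single_apply, hj₀ x hx] at h10

end LinearSystem

/-! ### Hypersurfaces are nowhere dense -/

section Meagre

variable {T : Type*} [NormedAddCommGroup T] [NormedSpace ℂ T]

/-- If the closure had interior points, `h` would by continuity vanish on a nonempty open set, and
so would its derivative. -/
theorem isNowhereDense_hypersurface {V : Set T} {h : T → ℂ} (hV : IsOpen V)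
    (hh : AnalyticOnNhd ℂ h V) (hd : ∀ y ∈ V, fderiv ℂ h y ≠ 0) :
    IsNowhereDense {y ∈ V | h y = 0} := by
  rw [IsNowhereDense, eq_empty_iff_forall_notMem]
  intro y hy
  obtain ⟨z, hzO, hzV, -⟩ := mem_closure_iff.1 (interior_subset hy) _ isOpen_interior hy
  refine hd z hzV ?_
  have h0 : ∀ᶠ x in 𝓝 z, h x = 0 := by
    filter_upwards [isOpen_interior.mem_nhds hzO, hV.mem_nhds hzV] with x hx hxV
    have hf : ∃ᶠ u in 𝓝 x, h u ∈ ({0} : Set ℂ) :=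
      (mem_closure_iff_frequently.1 (interior_subset hx)).mono fun u hu => hu.2
    exact isClosed_singleton.mem_of_frequently_of_tendsto hf (hh x hxV).continuousAt
  have h1 : h =ᶠ[𝓝 z] fun _ => 0 := h0
  rw [h1.fderiv_eq]
  simp

end Meagre

/-! ### From affine charts to projective space -/

namespace ProjSpace

variable {N : ℕ}

theorem isOpenEmbedding_ofAffine (i : Fin (N + 1)) :
    Topology.IsOpenEmbedding (ofAffine (N := N) i) :=
  (affineChart i).symm.isOpenEmbedding rfl

theorem ofAffine_mem_chartSource (i : Fin (N + 1)) (w : Fin N → ℂ) :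
    ofAffine i w ∈ chartSource i :=
  (affineChart i).map_target (mem_univ w)

theorem toAffine_ofAffine (i : Fin (N + 1)) (w : Fin N → ℂ) : toAffine i (ofAffine i w) = w :=
  (affineChart i).right_inv (mem_univ w)

theorem ofAffine_toAffine {i : Fin (N + 1)} {p : ℙ ℂ (Fin (N + 1) → ℂ)}
    (hp : p ∈ chartSource i) : ofAffine i (toAffine i p) = p :=
  (affineChart i).left_inv hp

theorem contMDiffOn_toAffine (i : Fin (N + 1)) :
    ContMDiffOn 𝓘(ℂ, Fin N → ℂ) 𝓘(ℂ, Fin N → ℂ) ω (toAffine i) (chartSource i) :=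
  contMDiffOn_of_mem_maximalAtlas (e := affineChart i)
    (IsManifold.subset_maximalAtlas (mem_range_self i))

theorem contMDiff_ofAffine (i : Fin (N + 1)) :
    ContMDiff 𝓘(ℂ, Fin N → ℂ) 𝓘(ℂ, Fin N → ℂ) ω (ofAffine (N := N) i) := by
  rw [← contMDiffOn_univ]
  exact contMDiffOn_symm_of_mem_maximalAtlas (e := affineChart i)
    (IsManifold.subset_maximalAtlas (mem_range_self i))

variable {i : Fin (N + 1)} {V : Set (Fin N → ℂ)} {h : (Fin N → ℂ) → ℂ}

theorem isLocallyClosedAnalytic_image_ofAffine (hV : IsOpen V) (hh : AnalyticOnNhd ℂ h V) :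
    IsLocallyClosedAnalytic (Fin N → ℂ) (ofAffine i '' {y ∈ V | h y = 0}) := by
  rintro _ ⟨y, ⟨hyV, -⟩, rfl⟩
  refine ⟨ofAffine i '' V, (isOpenEmbedding_ofAffine i).isOpenMap _ hV, mem_image_of_mem _ hyV, 1,
    fun _ p => h (toAffine i p), fun _ => ?_, ?_⟩
  · refine (hh.contDiffOn hV.uniqueDiffOn).contMDiffOn.comp
      ((contMDiffOn_toAffine i).mono ?_) ?_
    · rintro _ ⟨z, -, rfl⟩
      exact ofAffine_mem_chartSource i z
    · rintro _ ⟨z, hz, rfl⟩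
      rwa [mem_preimage, toAffine_ofAffine]
  · ext p
    constructor
    · rintro ⟨⟨z, ⟨hzV, hz0⟩, rfl⟩, hp⟩
      exact ⟨hp, fun _ => (congrArg h (toAffine_ofAffine i z)).trans hz0⟩
    · rintro ⟨⟨z, hz, rfl⟩, h0⟩
      have h1 : h (toAffine i (ofAffine i z)) = 0 := h0 0
      rw [toAffine_ofAffine] at h1
      exact ⟨⟨z, ⟨hz, h1⟩, rfl⟩, mem_image_of_mem _ hz⟩

/-- An immersed piece, read in the chart as `ψ`, satisfies `h ∘ ψ = 0`. The range of its injective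
derivative then lies in the hyperplane `ker dh`, so `d < N`. -/
theorem hasCodimAtLeast_image_ofAffine (hh : AnalyticOnNhd ℂ h V)
    (hd : ∀ y ∈ V, fderiv ℂ h y ≠ 0) :
    HasCodimAtLeast (Fin N → ℂ) 1 (ofAffine i '' {y ∈ V | h y = 0}) := by
  rintro d ⟨B, φ, hB, ⟨b, hb⟩, hφ, hinj, hsub⟩
  have hsub' : ∀ x ∈ B, φ x ∈ chartSource i ∧ toAffine i (φ x) ∈ V ∧ h (toAffine i (φ x)) = 0 := by
    intro x hx
    obtain ⟨y, hy, hyx⟩ := hsub (mem_image_of_mem φ hx)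
    rw [← hyx, toAffine_ofAffine]
    exact ⟨ofAffine_mem_chartSource i y, hy⟩
  set ψ : (Fin d → ℂ) → (Fin N → ℂ) := fun x => toAffine i (φ x) with hψdef
  have hψ : ContMDiffOn 𝓘(ℂ, Fin d → ℂ) 𝓘(ℂ, Fin N → ℂ) ω ψ B :=
    (contMDiffOn_toAffine i).comp hφ fun x hx => (hsub' x hx).1
  have hψb : MDifferentiableAt 𝓘(ℂ, Fin d → ℂ) 𝓘(ℂ, Fin N → ℂ) ψ b :=
    (hψ.contMDiffAt (hB.mem_nhds hb)).mdifferentiableAt (by simp)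
  have hψd : DifferentiableAt ℂ ψ b := hψb.differentiableAt
  have hinjψ : Function.Injective (fderiv ℂ ψ b) := by
    have heq : φ =ᶠ[𝓝 b] fun x => ofAffine i (ψ x) :=
      eventually_of_mem (hB.mem_nhds hb) fun x hx => (ofAffine_toAffine (hsub' x hx).1).symm
    have h1 := hinj b hb
    rw [heq.mfderiv_eq] at h1
    have h2 := mfderiv_comp (I' := 𝓘(ℂ, Fin N → ℂ)) b
      ((contMDiff_ofAffine i).contMDiffAt.mdifferentiableAt (x := ψ b) (by simp)) hψb
    intro u u' huu
    apply h1
    change mfderiv 𝓘(ℂ, Fin d → ℂ) 𝓘(ℂ, Fin N → ℂ) (ofAffine i ∘ ψ) b u =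
      mfderiv 𝓘(ℂ, Fin d → ℂ) 𝓘(ℂ, Fin N → ℂ) (ofAffine i ∘ ψ) b u'
    rw [h2, mfderiv_eq_fderiv (f := ψ)]
    exact congrArg (mfderiv 𝓘(ℂ, Fin N → ℂ) 𝓘(ℂ, Fin N → ℂ) (ofAffine i) (ψ b)) huu
  have hhb := (hh (ψ b) (hsub' b hb).2.1).differentiableAt
  have hzero : (fderiv ℂ h (ψ b)).comp (fderiv ℂ ψ b) = 0 := by
    rw [← fderiv_fun_comp b hhb hψd]
    have heq : (fun x => h (ψ x)) =ᶠ[𝓝 b] fun _ => 0 :=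
      eventually_of_mem (hB.mem_nhds hb) fun x hx => (hsub' x hx).2.2
    rw [heq.fderiv_eq]
    simp
  have hker : (fderiv ℂ h (ψ b)).ker ≠ ⊤ := by
    intro htop
    refine hd _ (hsub' b hb).2.1 (ContinuousLinearMap.ext fun u => ?_)
    have : u ∈ (fderiv ℂ h (ψ b)).ker := by rw [htop]; trivial
    exact this
  have hle : (fderiv ℂ ψ b).range ≤ (fderiv ℂ h (ψ b)).ker := by
    rintro _ ⟨u, rfl⟩
    exact DFunLike.congr_fun hzero u
  have h1 := Submodule.finrank_mono hle
  have h2 := Submodule.finrank_lt hker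
  have h3 := LinearMap.finrank_range_of_inj
    (f := ((fderiv ℂ ψ b : (Fin d → ℂ) →L[ℂ] (Fin N → ℂ)) : (Fin d → ℂ) →ₗ[ℂ] (Fin N → ℂ))) hinjψ
  rw [Module.finrank_fin_fun] at h3
  have h4 : finrank ℂ (fderiv ℂ ψ b).range = d := h3
  omega

/-- A set which is thin in affine charts is analytically meagre. -/
theorem analyticallyMeagre_iUnion_image_ofAffine {S : Fin (N + 1) → Set (Fin N → ℂ)}
    (hS : ∀ i, Thin (S i)) :
    AnalyticallyMeagre (Fin N → ℂ) (⋃ i, ofAffine i '' S i) := by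
  choose V h hV hSV using hS
  obtain ⟨e, he⟩ := exists_surjective_nat (Fin (N + 1) × ℕ)
  refine ⟨fun n => ofAffine (e n).1 '' {y ∈ V (e n).1 (e n).2 | h (e n).1 (e n).2 y = 0},
    fun n => ⟨?_, ?_⟩, ?_⟩
  · exact isLocallyClosedAnalytic_image_ofAffine (hV _ _).1 (hV _ _).2.1
  · exact hasCodimAtLeast_image_ofAffine (hV _ _).2.1 (hV _ _).2.2
  · refine iUnion_subset fun i => ?_
    rintro _ ⟨w, hw, rfl⟩
    obtain ⟨k, hk⟩ := mem_iUnion.1 (hSV i hw)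
    obtain ⟨n, hn⟩ := he (i, k)
    refine mem_iUnion.2 ⟨n, ?_⟩
    rw [hn]
    exact mem_image_of_mem _ hk

theorem isMeagre_image_ofAffine {S : Set (Fin N → ℂ)} (hS : Thin S) :
    IsMeagre (ofAffine i '' S) := by
  obtain ⟨V, h, hV, hSV⟩ := hS
  refine IsMeagre.mono (s := ⋃ n, ofAffine i '' {y ∈ V n | h n y = 0}) ?_ ?_
  rotate_left
  · refine isMeagre_iUnion fun n => IsNowhereDense.isMeagre ?_
    exact (isOpenEmbedding_ofAffine i).isInducing.isNowhereDense_image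
      (isNowhereDense_hypersurface (hV n).1 (hV n).2.1 (hV n).2.2)
  · rw [← image_iUnion]
    exact image_mono hSV

/-- Pull back along an affine chart meeting the given open set and apply Baire's theorem in `ℂ ^ N`.
-/
theorem dense_compl_of_isMeagre {S : Set (ℙ ℂ (Fin (N + 1) → ℂ))} (hS : IsMeagre S) :
    Dense Sᶜ := by
  rw [dense_iff_inter_open]
  rintro W hW ⟨p, hp⟩
  obtain ⟨i, hi⟩ := exists_mem_chartSource p
  have hemb := isOpenEmbedding_ofAffine (N := N) i
  have h1 : IsMeagre (ofAffine i ⁻¹' S) := hS.preimage_of_isOpenMap hemb.continuous hemb.isOpenMap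
  obtain ⟨w, hwW, hwS⟩ := (dense_of_mem_residual h1).inter_open_nonempty _
    (hW.preimage hemb.continuous) ⟨toAffine i p, by rwa [mem_preimage, ofAffine_toAffine hi]⟩
  exact ⟨ofAffine i w, hwW, hwS⟩

end ProjSpace

/-! ### Sections, local equations and base points -/

section Sections

variable {E : Type*} [NormedAddCommGroup E] [NormedSpace ℂ E]
  {M : Type*} [TopologicalSpace M] [ChartedSpace E M]
  {L : M → Type*} [TopologicalSpace (TotalSpace ℂ L)] [∀ x, AddCommGroup (L x)]
  [∀ x, Module ℂ (L x)] [∀ x, TopologicalSpace (L x)] [FiberBundle ℂ L] [VectorBundle ℂ ℂ L]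

theorem sum_smul_section_apply {ι : Type*} [Fintype ι] (v : ι → ℂ)
    (t : ι → Cₛ^ω⟮𝓘(ℂ, E); ℂ, L⟯) (x : M) : (∑ l, v l • t l) x = ∑ l, v l • t l x := by
  rw [← ContMDiffSection.coeAddHom_apply, map_sum, Finset.sum_apply]
  rfl

theorem localEquation_eq_linearMapAt (s : Cₛ^ω⟮𝓘(ℂ, E); ℂ, L⟯) (x : M) {y : M}
    (hy : y ∈ (trivializationAt ℂ L x).baseSet) :
    localEquation s x y = (trivializationAt ℂ L x).linearMapAt ℂ y (s y) := by
  rw [Trivialization.coe_linearMapAt_of_mem _ hy]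
  rfl

theorem localEquation_eq_zero_iff (s : Cₛ^ω⟮𝓘(ℂ, E); ℂ, L⟯) (x : M) {y : M}
    (hy : y ∈ (trivializationAt ℂ L x).baseSet) : localEquation s x y = 0 ↔ s y = 0 := by
  rw [localEquation_eq_linearMapAt s x hy, Trivialization.linearMapAt_def_of_mem _ hy]
  exact LinearEquiv.map_eq_zero_iff _

theorem contMDiffOn_localEquation [IsManifold 𝓘(ℂ, E) ω M] [ContMDiffVectorBundle ω ℂ L 𝓘(ℂ, E)]
    (s : Cₛ^ω⟮𝓘(ℂ, E); ℂ, L⟯) (x : M) :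
    ContMDiffOn 𝓘(ℂ, E) 𝓘(ℂ, ℂ) ω (localEquation s x) (trivializationAt ℂ L x).baseSet :=
  (Trivialization.contMDiffOn_section_baseSet_iff (trivializationAt ℂ L x)).1
    s.contMDiff.contMDiffOn

/-- Generating sections have no common zero. -/
theorem GeneratesLineBundle.exists_ne_zero [IsManifold 𝓘(ℂ, E) ω M]
    [ContMDiffVectorBundle ω ℂ L 𝓘(ℂ, E)] {ι : Type*} {t : ι → Cₛ^ω⟮𝓘(ℂ, E); ℂ, L⟯}
    (ht : GeneratesLineBundle (Submodule.span ℂ (range t))) (x : M) : ∃ l, t l x ≠ 0 := by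
  by_contra! h0
  set e := trivializationAt ℂ L x
  have hx : x ∈ e.baseSet := mem_baseSet_trivializationAt ℂ L x
  have hσ : ∀ y ∈ e.baseSet, (e ⟨y, e.symm y 1⟩).2 = 1 := by
    intro y hy
    rw [e.apply_mk_symm hy]
  -- Test generation on the local frame with constant coordinate `1`: a common zero of all `t l` at
  -- `x` would force the frame to vanish there.
  obtain ⟨U', -, hxU', -, k, w, g, hw, -, hsum⟩ := ht e.baseSet (fun y => e.symm y 1)
    e.open_baseSet
    ((Trivialization.contMDiffOn_section_baseSet_iff e).2
      ((contMDiffOn_const (c := (1 : ℂ))).congr hσ)) x hx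
  have hzero : ∀ s ∈ Submodule.span ℂ (range t), s x = 0 := by
    intro s hs
    induction hs using Submodule.span_induction with
    | mem s hs =>
      obtain ⟨l, rfl⟩ := hs
      exact h0 l
    | zero => rfl
    | add s s' _ _ h h' => rw [ContMDiffSection.coe_add, Pi.add_apply, h, h', add_zero]
    | smul c s _ h => rw [ContMDiffSection.coe_smul, Pi.smul_apply, h, smul_zero]
  have h1 : e.symm x (1 : ℂ) = 0 := by
    rw [hsum x hxU']
    exact Finset.sum_eq_zero fun j _ => by rw [hzero _ (hw j), smul_zero]
  have h2 : e.linearMapAt ℂ x (e.symm x (1 : ℂ)) = 1 := by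
    rw [Trivialization.coe_linearMapAt_of_mem _ hx]
    exact hσ x hx
  rw [h1, map_zero] at h2
  exact zero_ne_one h2

/-- If every zero of `s` is simple, then `s` vanishes identically on no component. -/
theorem hasSmoothDivisor_of_mfderiv_ne_zero {s : Cₛ^ω⟮𝓘(ℂ, E); ℂ, L⟯}
    (h : ∀ x : M, s x = 0 → mfderiv 𝓘(ℂ, E) 𝓘(ℂ, ℂ) (localEquation s x) x ≠ 0) :
    HasSmoothDivisor s := by
  refine ⟨fun x => ?_, h⟩
  by_contra! h0
  have : LocallyConnectedSpace M := ChartedSpace.locallyConnectedSpace E M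
  refine h x (h0 x mem_connectedComponent) ?_
  have heq : localEquation s x =ᶠ[𝓝 x] fun _ => 0 := by
    filter_upwards [isOpen_connectedComponent.mem_nhds (mem_connectedComponent (x := x)),
      (trivializationAt ℂ L x).open_baseSet.mem_nhds (mem_baseSet_trivializationAt ℂ L x)]
      with y hy hyb
    exact (localEquation_eq_zero_iff s x hyb).2 (h0 y hy)
  rw [heq.mfderiv_eq]
  exact mfderiv_const

end Sections

/-! ### Reduction of sections to functions near a point -/

section Local

open ProjSpace

variable {E : Type*} [NormedAddCommGroup E] [NormedSpace ℂ E]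
  {M : Type*} [TopologicalSpace M] [ChartedSpace E M] [IsManifold 𝓘(ℂ, E) ω M]
  {L : M → Type*} [TopologicalSpace (TotalSpace ℂ L)] [∀ x, AddCommGroup (L x)]
  [∀ x, Module ℂ (L x)] [∀ x, TopologicalSpace (L x)] [FiberBundle ℂ L] [VectorBundle ℂ ℂ L]
  [ContMDiffVectorBundle ω ℂ L 𝓘(ℂ, E)]

/-- If `s = ζ • τ` near a zero `x` of `s` at which the local equation has vanishing differential,
and `τ` has no zero, then `ζ`, read in a chart, has a singular zero at `x`. -/
theorem fderiv_eq_zero_of_mfderiv_localEquation_eq_zero {s τ : Cₛ^ω⟮𝓘(ℂ, E); ℂ, L⟯} {x₀ x : M}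
    (hx : x ∈ (chartAt E x₀).source) {ζ : E → ℂ} (hζ : DifferentiableAt ℂ ζ (chartAt E x₀ x))
    (hsτ : ∀ᶠ y in 𝓝 (chartAt E x₀ x),
      s ((chartAt E x₀).symm y) = ζ y • τ ((chartAt E x₀).symm y))
    (hτ : τ x ≠ 0) (hs : s x = 0)
    (hd : mfderiv 𝓘(ℂ, E) 𝓘(ℂ, ℂ) (localEquation s x) x = 0) :
    ζ (chartAt E x₀ x) = 0 ∧ fderiv ℂ ζ (chartAt E x₀ x) = 0 := by
  set c := chartAt E x₀
  have hcx : c.symm (c x) = x := c.left_inv hx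
  have hxb : x ∈ (trivializationAt ℂ L x).baseSet := mem_baseSet_trivializationAt ℂ L x
  have hζ0 : ζ (c x) = 0 := by
    have h1 := hsτ.self_of_nhds
    rw [hcx, hs] at h1
    exact (smul_eq_zero.1 h1.symm).resolve_right hτ
  refine ⟨hζ0, ?_⟩
  have hcs : MDifferentiableAt 𝓘(ℂ, E) 𝓘(ℂ, E) c.symm (c x) :=
    (((contMDiffOn_chart_symm (n := ω)) : ContMDiffOn 𝓘(ℂ, E) 𝓘(ℂ, E) ω c.symm c.target).contMDiffAt
      (c.open_target.mem_nhds (c.map_source hx))).mdifferentiableAt (by simp)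
  have hloc : ∀ σ : Cₛ^ω⟮𝓘(ℂ, E); ℂ, L⟯,
      MDifferentiableAt 𝓘(ℂ, E) 𝓘(ℂ, ℂ) (localEquation σ x) (c.symm (c x)) := by
    intro σ
    rw [hcx]
    exact ((contMDiffOn_localEquation σ x).contMDiffAt
      ((trivializationAt ℂ L x).open_baseSet.mem_nhds hxb)).mdifferentiableAt (by simp)
  have hB : DifferentiableAt ℂ (fun y => localEquation τ x (c.symm y)) (c x) :=
    ((hloc τ).comp (c x) hcs).differentiableAt
  have hA : fderiv ℂ (fun y => localEquation s x (c.symm y)) (c x) = 0 := by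
    have h1 := mfderiv_comp (c x) (hloc s) hcs
    rw [hcx, hd, mfderiv_eq_fderiv] at h1
    exact h1.trans (ContinuousLinearMap.zero_comp _)
  have heq : (fun y => localEquation s x (c.symm y)) =ᶠ[𝓝 (c x)]
      fun y => ζ y * localEquation τ x (c.symm y) := by
    have hcont : ContinuousAt c.symm (c x) := hcs.continuousAt
    filter_upwards [hsτ, hcont.preimage_mem_nhds (by
      rw [hcx]; exact (trivializationAt ℂ L x).open_baseSet.mem_nhds hxb)] with y hy hyb
    rw [localEquation_eq_linearMapAt s x hyb, localEquation_eq_linearMapAt τ x hyb, hy, map_smul,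
      smul_eq_mul]
  -- In the Leibniz rule the term with `ζ (c x) = 0` drops out, leaving `dζ` times the nonzero local
  -- value of `τ`.
  rw [heq.fderiv_eq, fderiv_fun_mul hζ hB] at hA
  ext u
  have h1 : ζ (c x) * fderiv ℂ (fun y => localEquation τ x (c.symm y)) (c x) u +
      localEquation τ x (c.symm (c x)) * fderiv ℂ ζ (c x) u = 0 := DFunLike.congr_fun hA u
  rw [hζ0, zero_mul, zero_add, hcx] at h1
  exact (mul_eq_zero.1 h1).resolve_left fun h => hτ ((localEquation_eq_zero_iff τ x hxb).1 h)

/-- Locally on `M`, the members of the linear system with a singular zero form a set which is thin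
in affine coordinates. -/
theorem exists_nhds_thin_singular_sections [FiniteDimensional ℂ E] {N : ℕ}
    {t : Fin (N + 1) → Cₛ^ω⟮𝓘(ℂ, E); ℂ, L⟯} {x₀ : M} {l₀ : Fin (N + 1)} (hl₀ : t l₀ x₀ ≠ 0) :
    ∃ O ∈ 𝓝 x₀, ∃ S : Fin (N + 1) → Set (Fin N → ℂ), (∀ i, Thin (S i)) ∧
      ∀ (v : Fin (N + 1) → ℂ) (hv : v ≠ 0), ∀ x ∈ O, (∑ l, v l • t l) x = 0 →
        mfderiv 𝓘(ℂ, E) 𝓘(ℂ, ℂ) (localEquation (∑ l, v l • t l) x) x = 0 →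
        ∃ i, Projectivization.mk ℂ v hv ∈ ofAffine i '' S i := by
  classical
  set e := trivializationAt ℂ L x₀
  set c := chartAt E x₀
  have hx₀ : x₀ ∈ e.baseSet := mem_baseSet_trivializationAt ℂ L x₀
  have hloc := fun l => contMDiffOn_localEquation (t l) x₀
  have hcs : ContMDiffOn 𝓘(ℂ, E) 𝓘(ℂ, E) ω c.symm c.target := contMDiffOn_chart_symm
  set U₁ : Set E := c.target ∩ c.symm ⁻¹' e.baseSet with hU₁def
  have hU₁ : IsOpen U₁ := c.isOpen_inter_preimage_symm e.open_baseSet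
  set τ : Fin (N + 1) → E → ℂ := fun l y => localEquation (t l) x₀ (c.symm y) with hτdef
  have hτ : ∀ l, AnalyticOnNhd ℂ (τ l) U₁ := by
    intro l
    have h1 : ContMDiffOn 𝓘(ℂ, E) 𝓘(ℂ, ℂ) ω (τ l) U₁ :=
      (hloc l).comp (hcs.mono inter_subset_left) inter_subset_right
    exact hU₁.analyticOn_iff_analyticOnNhd.1 h1.contDiffOn.analyticOn
  set U : Set E := U₁ ∩ {y | τ l₀ y ≠ 0}
  have hU : IsOpen U := (hτ l₀).continuousOn.isOpen_inter_preimage hU₁ isOpen_ne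
  have hUne : ∀ y ∈ U, t l₀ (c.symm y) ≠ 0 := fun y hy h =>
    hy.2 ((localEquation_eq_zero_iff (t l₀) x₀ hy.1.2).2 h)
  set q : Fin (N + 1) → E → ℂ := fun l y => τ l y / τ l₀ y
  have hq : ∀ l, AnalyticOnNhd ℂ (q l) U := fun l y hy =>
    (hτ l y hy.1).div (hτ l₀ y hy.1) hy.2
  have hq₀ : ∀ y ∈ U, q l₀ y = 1 := fun y hy => div_self hy.2
  have hts : ∀ v : Fin (N + 1) → ℂ, ∀ y ∈ U, (∑ l, v l • t l) (c.symm y) =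
      (∑ l, v l * q l y) • t l₀ (c.symm y) := by
    intro v y hy
    rw [sum_smul_section_apply, Finset.sum_smul]
    refine Finset.sum_congr rfl fun l _ => ?_
    rw [mul_smul]
    congr 1
    apply (e.linearEquivAt ℂ (c.symm y) hy.1.2).injective
    rw [map_smul]
    change τ l y = q l y * τ l₀ y
    exact (div_mul_cancel₀ _ hy.2).symm
  -- In a chart `i ≠ l₀` the function `q l₀ = 1` has a free coefficient, as `thin_singular_members`
  -- requires. The chart `l₀` can be left empty, since every bad member is visible in another one.
  set S : Fin (N + 1) → Set (Fin N → ℂ) := fun i => if i = l₀ then ∅ else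
    {w | ∃ y ∈ U, q i y + ∑ j, w j * q (i.succAbove j) y = 0 ∧
      fderiv ℂ (fun y => q i y + ∑ j, w j * q (i.succAbove j) y) y = 0} with hSdef
  refine ⟨c.source ∩ c ⁻¹' U, ?_, S, ?_, ?_⟩
  · have hcx₀ := mem_chart_source E x₀
    refine inter_mem (c.open_source.mem_nhds hcx₀)
      ((c.continuousAt hcx₀).preimage_mem_nhds (hU.mem_nhds ?_))
    have hcc : c.symm (c x₀) = x₀ := c.left_inv hcx₀
    refine ⟨⟨c.map_source hcx₀, ?_⟩, ?_⟩
    · rwa [mem_preimage, hcc]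
    · change localEquation (t l₀) x₀ (c.symm (c x₀)) ≠ 0
      rw [hcc]
      exact fun h => hl₀ ((localEquation_eq_zero_iff (t l₀) x₀ hx₀).1 h)
  · intro i
    by_cases hi : i = l₀
    · simp only [hSdef, if_pos hi]
      exact thin_empty
    · simp only [hSdef, if_neg hi]
      obtain ⟨j₀, hj₀⟩ := Fin.exists_succAbove_eq (Ne.symm hi)
      exact thin_singular_members hU (hq i) (fun j => hq (i.succAbove j)) (j₀ := j₀)
        (by rw [hj₀]; exact hq₀)
  · rintro v hv x ⟨hxc, hxU : c x ∈ U⟩ hs hd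
    have hcx : c.symm (c x) = x := c.left_inv hxc
    have hτx : t l₀ x ≠ 0 := by
      rw [← hcx]
      exact hUne _ hxU
    -- Otherwise the section is a multiple of `t l₀`, which is nonzero at `x`; its zero at `x` would
    -- give `v = 0`.
    obtain ⟨i, hi, hvi⟩ : ∃ i, i ≠ l₀ ∧ v i ≠ 0 := by
      by_contra! h0
      rw [sum_smul_section_apply, Finset.sum_eq_single l₀
        (fun l _ hl => by rw [h0 l hl, zero_smul]) (by simp)] at hs
      have hvl := (smul_eq_zero.1 hs).resolve_right hτx
      refine hv (funext fun l => ?_)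
      by_cases hl : l = l₀
      · rw [hl, hvl, Pi.zero_apply]
      · exact h0 l hl
    have hζ : DifferentiableAt ℂ (fun y => ∑ l, v l * q l y) (c x) :=
      DifferentiableAt.fun_sum fun l _ => (hq l _ hxU).differentiableAt.const_mul _
    obtain ⟨hζ0, hζd⟩ := fderiv_eq_zero_of_mfderiv_localEquation_eq_zero hxc hζ
      (eventually_of_mem (hU.mem_nhds hxU) (hts v)) hτx hs hd
    have hp : Projectivization.mk ℂ v hv ∈ chartSource i := hvi
    have hfun : (fun y => q i y + ∑ j, toAffine i (Projectivization.mk ℂ v hv) j *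
        q (i.succAbove j) y) = fun y => (v i)⁻¹ * ∑ l, v l * q l y := by
      funext y
      rw [Fin.sum_univ_succAbove _ i, mul_add, inv_mul_cancel_left₀ hvi, Finset.mul_sum]
      congr 1
      refine Finset.sum_congr rfl fun j _ => ?_
      change v (i.succAbove j) / v i * _ = _
      rw [div_eq_inv_mul, mul_assoc]
    refine ⟨i, toAffine i (Projectivization.mk ℂ v hv), ?_, ofAffine_toAffine hp⟩
    simp only [hSdef, if_neg hi]
    refine ⟨c x, hxU, ?_, ?_⟩
    · exact (congrFun hfun (c x)).trans (mul_eq_zero_of_right _ hζ0)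
    · rw [hfun, fderiv_const_mul hζ]
      ext u
      exact mul_eq_zero_of_right _ (DFunLike.congr_fun hζd u)

end Local

/-! ### The Bertini theorem -/

open ProjSpace in
theorem theorem3p2
    {E : Type*} [NormedAddCommGroup E] [NormedSpace ℂ E] [FiniteDimensional ℂ E]
    {M : Type*} [TopologicalSpace M] [T2Space M] [SecondCountableTopology M]
    [ChartedSpace E M] [IsManifold 𝓘(ℂ, E) ω M] [Finite (ConnectedComponents M)]
    {L : M → Type*} [TopologicalSpace (TotalSpace ℂ L)] [∀ x, AddCommGroup (L x)]
    [∀ x, Module ℂ (L x)] [∀ x, TopologicalSpace (L x)] [FiberBundle ℂ L]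
    [VectorBundle ℂ ℂ L] [ContMDiffVectorBundle ω ℂ L 𝓘(ℂ, E)]
    (N : ℕ) (t : Fin (N + 1) → Cₛ^ω⟮𝓘(ℂ, E); ℂ, L⟯)
    (ht : GeneratesLineBundle (Submodule.span ℂ (range t))) :
    ∃ D : Set (ℙ ℂ (Fin (N + 1) → ℂ)),
      Dense D ∧
      AnalyticallyMeagre (Fin N → ℂ) Dᶜ ∧
      ∀ (v : Fin (N + 1) → ℂ) (hv : v ≠ 0),
        Projectivization.mk ℂ v hv ∈ D → HasSmoothDivisor (∑ l, v l • t l) := by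
  choose l₀ hl₀ using ht.exists_ne_zero
  choose O hO S hS hbad using fun x => exists_nhds_thin_singular_sections (hl₀ x)
  obtain ⟨c, hc, hcov⟩ := TopologicalSpace.countable_cover_nhds hO
  have : Countable c := hc.to_subtype
  have hT : ∀ i, Thin (⋃ x : c, S x i) := fun i => thin_iUnion fun x => hS x i
  -- Discard the bad parameters of countably many neighbourhoods covering `M`, in all affine charts.
  refine ⟨(⋃ i, ofAffine i '' ⋃ x : c, S x i)ᶜ, ?_, ?_, ?_⟩
  · exact dense_compl_of_isMeagre (isMeagre_iUnion fun i => isMeagre_image_ofAffine (hT i))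
  · rw [compl_compl]
    exact analyticallyMeagre_iUnion_image_ofAffine hT
  · intro v hv hD
    refine hasSmoothDivisor_of_mfderiv_ne_zero fun x hx hd => hD ?_
    obtain ⟨x₀, hx₀, hxO⟩ := mem_iUnion₂.1 (hcov.symm ▸ mem_univ x : x ∈ ⋃ x ∈ c, O x)
    obtain ⟨i, w, hw, hwv⟩ := hbad x₀ v hv x hxO hx hd
    exact mem_iUnion.2 ⟨i, w, mem_iUnion.2 ⟨⟨x₀, hx₀⟩, hw⟩, hwv⟩
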